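/- Let $Q\subset\mathbb R^2$ be a centrally symmetric convex polygon (the convex hull of finitely many points, with nonempty interior, invariant under the reflection in some point). Then there is a constant $\alpha_Q>0$, depending only on $Q$, such that for every locally finite set $S\subset\mathbb R^2$ (that is, every compact subset of the plane contains only finitely many points of $S$) and every integer $k\ge 1$, the points of $S$ can be colored with $k$ colors so that every translate of $Q$ that contains at least $\alpha_Q k$ points of $S$ contains at least one point of $S$ of each of the $k$ colors. -/

import Mathlib

open scoped Pointwise

/-- The Euclidean plane. -/
abbrev Plane : Type := EuclideanSpace ℝ (Fin 2)

/-- A (closed, solid, non-degenerate) convex polygon: the convex hull of finitely many points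
of the plane, with nonempty interior. -/
def IsConvexPolygon (Q : Set Plane) : Prop :=
  (∃ V : Set Plane, V.Finite ∧ Q = convexHull ℝ V) ∧ (interior Q).Nonempty

/-- A set is centrally symmetric if it is invariant under the reflection in some point. -/
def IsCentrallySymmetric (Q : Set Plane) : Prop :=
  ∃ c : Plane, (Equiv.pointReflection c) '' Q = Q

/-- Every compact region contains only finitely many points of `S`. -/
def IsLocallyFinite (S : Set Plane) : Prop :=
  ∀ K : Set Plane, IsCompact K → (S ∩ K).Finite

/-! Cut the plane into cells so small that, inside one cell, a translate of `Q` is cut out by at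
most two edge constraints, hence is a quadrant in one of finitely many coordinate types `Γ`. A
translate meets at most `M` cells, so by pigeonhole a rich translate is rich in some cell, and the
cells can be colored independently. Both `Γ` and `M` depend on `Q` only.

In one cell, induct on `k` (`exists_coloring_wedge`). For each type, take a maximal disjoint family
of quadrants with exactly `r = 4 * Γ.card * k` points, and from each the points minimizing the two
coordinates. By `exists_sparse_hitting_set` these points meet every `r`-point quadrant of that type,
yet at most four of them lie in an `r`-point quadrant of any type. They receive the last color;
every `r`-point quadrant keeps at least `4 * Γ.card * (k - 1)` points for the others.

The bound of four needs quadrants of one type to be box-convex in the coordinates of every other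
type. This is where central symmetry enters, through extreme points of the polar
(`exists_local_wedges`). -/

/-! ### Coloring finite sets with respect to quadrants. -/

/-- The points of `S` lying in the quadrant `{a ≤ s, b ≤ t}`. -/
noncomputable def wedge {α : Type*} (a b : α → ℝ) (s t : ℝ) (S : Finset α) : Finset α :=
  S.filter fun x => a x ≤ s ∧ b x ≤ t

lemma mem_wedge {α : Type*} {a b : α → ℝ} {s t : ℝ} {S : Finset α} {x : α} :
    x ∈ wedge a b s t S ↔ x ∈ S ∧ a x ≤ s ∧ b x ≤ t := by
  simp [wedge]

/-- `D` contains every point of `S` whose `(a, b)`-coordinates lie strictly inside a box having two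
points of `D` as its upper left and lower right corners. -/
def BoxConvex {α : Type*} (a b : α → ℝ) (S D : Finset α) : Prop :=
  ∀ x ∈ D, ∀ z ∈ D, ∀ y ∈ S, a x < a y → a y < a z → b z < b y → b y < b x → y ∈ D

/-- Of two disjoint nonempty quadrants neither apex dominates the other. -/
lemma wedge_apex_lt_or_lt {α : Type*} {a b : α → ℝ} {S : Finset α} {s t s' t' : ℝ}
    (hd : Disjoint (wedge a b s t S) (wedge a b s' t' S))
    (h : (wedge a b s t S).Nonempty) (h' : (wedge a b s' t' S).Nonempty) :
    (s < s' ∧ t' < t) ∨ (s' < s ∧ t < t') := by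
  obtain ⟨x, hx⟩ := h
  obtain ⟨y, hy⟩ := h'
  have hx' := Finset.disjoint_left.1 hd hx
  have hy' := Finset.disjoint_right.1 hd hy
  rw [mem_wedge] at hx hy hx' hy'
  obtain ⟨hxS, hxa, hxb⟩ := hx
  obtain ⟨hyS, hya, hyb⟩ := hy
  rcases lt_or_ge s s' with h1 | h1
  · left
    refine ⟨h1, ?_⟩
    by_contra! h2
    exact hx' ⟨hxS, by linarith, by linarith⟩
  · right
    rcases le_or_gt t' t with h2 | h2
    · exact absurd ⟨hyS, by linarith, by linarith⟩ hy'
    · refine ⟨lt_of_le_of_ne h1 ?_, h2⟩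
      rintro rfl
      exact hx' ⟨hxS, hxa, by linarith⟩

/-- A box-convex set meeting the outer two of three disjoint quadrants swallows the middle one. -/
lemma card_middle_wedge_lt {α : Type*} [DecidableEq α] {a b : α → ℝ} {S D : Finset α}
    {s₁ t₁ s₂ t₂ s₃ t₃ : ℝ}
    (h12 : Disjoint (wedge a b s₁ t₁ S) (wedge a b s₂ t₂ S))
    (h23 : Disjoint (wedge a b s₂ t₂ S) (wedge a b s₃ t₃ S))
    (hs12 : s₁ < s₂) (hs23 : s₂ < s₃) (ht12 : t₂ < t₁) (ht23 : t₃ < t₂)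
    (hD : BoxConvex a b S D) {x z : α} (hx : x ∈ wedge a b s₁ t₁ S) (hxD : x ∈ D)
    (hz : z ∈ wedge a b s₃ t₃ S) (hzD : z ∈ D) : (wedge a b s₂ t₂ S).card < D.card := by
  have hx2 := Finset.disjoint_left.1 h12 hx
  refine Finset.card_lt_card (Finset.ssubset_iff_of_subset ?_ |>.2 ⟨x, hxD, hx2⟩)
  intro y hy
  have hy1 := Finset.disjoint_right.1 h12 hy
  have hy3 := Finset.disjoint_left.1 h23 hy
  have hz2 := Finset.disjoint_right.1 h23 hz
  rw [mem_wedge] at hx hz hy hx2 hy1 hy3 hz2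
  obtain ⟨hxS, hxa, hxb⟩ := hx
  obtain ⟨hyS, hya, hyb⟩ := hy
  obtain ⟨hzS, hza, hzb⟩ := hz
  have e1 : s₁ < a y := by
    by_contra! h
    exact hy1 ⟨hyS, h, by linarith⟩
  have e2 : t₃ < b y := by
    by_contra! h
    exact hy3 ⟨hyS, by linarith, h⟩
  have e3 : t₂ < b x := by
    by_contra! h
    exact hx2 ⟨hxS, by linarith, h⟩
  have e4 : s₂ < a z := by
    by_contra! h
    exact hz2 ⟨hzS, h, by linarith⟩
  exact hD x hxD z hzD y hyS (by linarith) (by linarith) (by linarith) (by linarith)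

/-- There is a set meeting every `r`-point quadrant, but meeting every box-convex set of at most
`r` points in at most four points. -/
lemma exists_sparse_hitting_set {α : Type*} [DecidableEq α] (S : Finset α) (a b : α → ℝ) {r : ℕ}
    (hr : 1 ≤ r) :
    ∃ T ⊆ S, (∀ s t, (wedge a b s t S).card = r → (T ∩ wedge a b s t S).Nonempty) ∧
      ∀ D : Finset α, D.card ≤ r → BoxConvex a b S D → (D ∩ T).card ≤ 4 := by
  classical
  have hU : ∀ W : Finset α, ∃ U ⊆ W, U.card ≤ 2 ∧ (W.Nonempty →
      (∃ x ∈ U, ∀ y ∈ W, a x ≤ a y) ∧ (∃ x ∈ U, ∀ y ∈ W, b x ≤ b y)) := by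
    intro W
    rcases W.eq_empty_or_nonempty with rfl | hW
    · exact ⟨∅, by simp⟩
    · obtain ⟨x, hx, hxm⟩ := W.exists_min_image a hW
      obtain ⟨y, hy, hym⟩ := W.exists_min_image b hW
      refine ⟨{x, y}, ?_, Finset.card_le_two, fun _ => ⟨⟨x, by simp, hxm⟩, ⟨y, by simp, hym⟩⟩⟩
      intro w hw
      rcases Finset.mem_insert.1 hw with rfl | hw
      · exact hx
      · rwa [Finset.mem_singleton.1 hw]
  choose U hUW hU2 hUm using hU
  set 𝒲 : Finset (Finset α) :=
    S.powerset.filter fun W => W.card = r ∧ ∃ s t, W = wedge a b s t S with h𝒲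
  have hWpos : ∀ W ∈ 𝒲, W.Nonempty := by
    intro W hW
    rw [← Finset.card_pos, (Finset.mem_filter.1 hW).2.1]
    exact hr
  obtain ⟨𝒱, h𝒱, hmax⟩ := Finset.exists_max_image
    (𝒲.powerset.filter fun 𝒱 => ∀ W ∈ 𝒱, ∀ W' ∈ 𝒱, W ≠ W' → Disjoint W W') Finset.card
    ⟨∅, by simp⟩
  obtain ⟨h𝒱𝒲, hdis⟩ := Finset.mem_filter.1 h𝒱
  rw [Finset.mem_powerset] at h𝒱𝒲
  refine ⟨𝒱.biUnion U, ?_, ?_, ?_⟩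
  · intro x hx
    obtain ⟨W, hW, hxW⟩ := Finset.mem_biUnion.1 hx
    exact Finset.mem_powerset.1 (Finset.mem_filter.1 (h𝒱𝒲 hW)).1 (hUW W hxW)
  · intro s t hst
    have hWmem : wedge a b s t S ∈ 𝒲 := by
      refine Finset.mem_filter.2 ⟨Finset.mem_powerset.2 (Finset.filter_subset _ _), hst, s, t, rfl⟩
    have hWne := hWpos _ hWmem
    have hmeet : ∃ W ∈ 𝒱, ¬ Disjoint W (wedge a b s t S) := by
      by_contra! hcon
      have hnot : wedge a b s t S ∉ 𝒱 := by
        intro h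
        exact hWne.ne_empty (disjoint_self.1 (hcon _ h))
      have := hmax (insert (wedge a b s t S) 𝒱) (by
        refine Finset.mem_filter.2 ⟨Finset.mem_powerset.2
          (Finset.insert_subset hWmem h𝒱𝒲), ?_⟩
        intro W hW W' hW' hne
        rcases Finset.mem_insert.1 hW with rfl | hW
        · rcases Finset.mem_insert.1 hW' with rfl | hW'
          · exact absurd rfl hne
          · exact (hcon _ hW').symm
        · rcases Finset.mem_insert.1 hW' with rfl | hW'
          · exact hcon _ hW
          · exact hdis _ hW _ hW' hne)
      rw [Finset.card_insert_of_notMem hnot] at this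
      omega
    obtain ⟨W, hW, hnd⟩ := hmeet
    obtain ⟨y, hyW, hy⟩ := Finset.not_disjoint_iff.1 hnd
    obtain ⟨⟨x, hxU, hx⟩, ⟨z, hzU, hz⟩⟩ := hUm W (hWpos W (h𝒱𝒲 hW))
    have hxT : x ∈ 𝒱.biUnion U := Finset.mem_biUnion.2 ⟨W, hW, hxU⟩
    have hzT : z ∈ 𝒱.biUnion U := Finset.mem_biUnion.2 ⟨W, hW, hzU⟩
    obtain ⟨hWS, hWr, s', t', hW'⟩ := Finset.mem_filter.1 (h𝒱𝒲 hW)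
    have hxW := hUW W hxU
    have hzW := hUW W hzU
    have hxy := hx y hyW
    have hzy := hz y hyW
    have hsub : s' ≤ s → t' ≤ t → W ⊆ wedge a b s t S := by
      intro h1 h2 w hw
      rw [hW', mem_wedge] at hw
      exact mem_wedge.2 ⟨hw.1, hw.2.1.trans h1, hw.2.2.trans h2⟩
    have hxW2 := hxW
    have hzW2 := hzW
    rw [hW', mem_wedge] at hxW2 hzW2
    rw [mem_wedge] at hy
    -- If the new quadrant extends past `W` in one direction, the point of `W` minimizing the other
    -- coordinate lies in it, because the common point `y` does. If it extends in neither, it lies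
    -- in `W` and equal cardinality makes them equal.
    rcases le_total s' s with h1 | h1 <;> rcases le_total t' t with h2 | h2
    · exact ⟨x, Finset.mem_inter.2 ⟨hxT, hsub h1 h2 hxW⟩⟩
    · exact ⟨z, Finset.mem_inter.2 ⟨hzT, mem_wedge.2
        ⟨hzW2.1, hzW2.2.1.trans h1, hzy.trans hy.2.2⟩⟩⟩
    · exact ⟨x, Finset.mem_inter.2 ⟨hxT, mem_wedge.2
        ⟨hxW2.1, hxy.trans hy.2.1, hxW2.2.2.trans h2⟩⟩⟩
    · have hsub' : wedge a b s t S ⊆ W := by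
        intro w hw
        rw [mem_wedge] at hw
        rw [hW', mem_wedge]
        exact ⟨hw.1, hw.2.1.trans h1, hw.2.2.trans h2⟩
      have := Finset.eq_of_subset_of_card_le hsub' (by rw [hWr, hst])
      exact ⟨x, Finset.mem_inter.2 ⟨hxT, this ▸ hxW⟩⟩
  · intro D hDr hD
    set 𝒬 := 𝒱.filter fun W => (U W ∩ D).Nonempty
    have hsub : D ∩ 𝒱.biUnion U ⊆ 𝒬.biUnion U := by
      intro x hx
      obtain ⟨hxD, hx⟩ := Finset.mem_inter.1 hx
      obtain ⟨W, hW, hxW⟩ := Finset.mem_biUnion.1 hx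
      exact Finset.mem_biUnion.2 ⟨W, Finset.mem_filter.2 ⟨hW, x, Finset.mem_inter.2 ⟨hxW, hxD⟩⟩,
        hxW⟩
    have h𝒬 : 𝒬.card ≤ 2 := by
      by_contra! hlt
      obtain ⟨W₁, W₂, W₃, h1, h2, h3, h12, h13, h23⟩ := Finset.two_lt_card_iff.1 hlt
      obtain ⟨h1, x₁, hx₁⟩ := Finset.mem_filter.1 h1
      obtain ⟨h2, x₂, hx₂⟩ := Finset.mem_filter.1 h2
      obtain ⟨h3, x₃, hx₃⟩ := Finset.mem_filter.1 h3
      obtain ⟨hx₁, hx₁D⟩ := Finset.mem_inter.1 hx₁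
      obtain ⟨hx₂, hx₂D⟩ := Finset.mem_inter.1 hx₂
      obtain ⟨hx₃, hx₃D⟩ := Finset.mem_inter.1 hx₃
      replace hx₁ := hUW _ hx₁
      replace hx₂ := hUW _ hx₂
      replace hx₃ := hUW _ hx₃
      have d12 := hdis _ h1 _ h2 h12
      have d13 := hdis _ h1 _ h3 h13
      have d23 := hdis _ h2 _ h3 h23
      have n1 := hWpos _ (h𝒱𝒲 h1)
      have n2 := hWpos _ (h𝒱𝒲 h2)
      have n3 := hWpos _ (h𝒱𝒲 h3)
      obtain ⟨-, c1, s₁, t₁, rfl⟩ := Finset.mem_filter.1 (h𝒱𝒲 h1)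
      obtain ⟨-, c2, s₂, t₂, rfl⟩ := Finset.mem_filter.1 (h𝒱𝒲 h2)
      obtain ⟨-, c3, s₃, t₃, rfl⟩ := Finset.mem_filter.1 (h𝒱𝒲 h3)
      -- The apexes form a descending chain. Six sign patterns are its possible orders, each making
      -- the middle `r`-point quadrant smaller than `D`; the other two are cyclic.
      rcases wedge_apex_lt_or_lt d12 n1 n2 with ⟨p, p'⟩ | ⟨p, p'⟩ <;>
      rcases wedge_apex_lt_or_lt d13 n1 n3 with ⟨q, q'⟩ | ⟨q, q'⟩ <;>
      rcases wedge_apex_lt_or_lt d23 n2 n3 with ⟨u, u'⟩ | ⟨u, u'⟩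
      · have := card_middle_wedge_lt d12 d23 p u p' u' hD hx₁ hx₁D hx₃ hx₃D
        omega
      · have := card_middle_wedge_lt d13 d23.symm q u q' u' hD hx₁ hx₁D hx₂ hx₂D
        omega
      · linarith
      · have := card_middle_wedge_lt d13.symm d12 q p q' p' hD hx₃ hx₃D hx₂ hx₂D
        omega
      · have := card_middle_wedge_lt d12.symm d13 p q p' q' hD hx₂ hx₂D hx₃ hx₃D
        omega
      · linarith
      · have := card_middle_wedge_lt d23 d13.symm u q u' q' hD hx₂ hx₂D hx₁ hx₁D
        omega
      · have := card_middle_wedge_lt d23.symm d12.symm u p u' p' hD hx₃ hx₃D hx₁ hx₁D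
        omega
    calc (D ∩ 𝒱.biUnion U).card ≤ (𝒬.biUnion U).card := Finset.card_le_card hsub
      _ ≤ 𝒬.card * 2 := Finset.card_biUnion_le_card_mul _ _ _ fun W _ => hU2 W
      _ ≤ 4 := by omega

/-- A quadrant with at least `r` points contains one with exactly `r` points. -/
lemma exists_wedge_card_eq {α : Type*} {S : Finset α} {a b : α → ℝ} (ha : Set.InjOn a S)
    {s t : ℝ} {r : ℕ} (h : r ≤ (wedge a b s t S).card) :
    ∃ s' ≤ s, (wedge a b s' t S).card = r := by
  classical
  induction hn : (wedge a b s t S).card generalizing s with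
  | zero => exact ⟨s, le_rfl, by omega⟩
  | succ n ih =>
    rcases h.eq_or_lt with h | h
    · exact ⟨s, le_rfl, h.symm⟩
    obtain ⟨x, hx, hxm⟩ := (wedge a b s t S).exists_max_image a
      (Finset.card_pos.1 (by omega))
    have hxw := mem_wedge.1 hx
    -- Lowering the bound to `s₀` drops exactly `x`, since no other point ties with it in the first
    -- coordinate.
    obtain ⟨s₀, hs₀, hs₀'⟩ : ∃ s₀ < a x, ∀ y ∈ wedge a b s t S, a y < a x → a y ≤ s₀ := by
      rcases ((wedge a b s t S).erase x).eq_empty_or_nonempty with he | he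
      · refine ⟨a x - 1, by linarith, fun y hy hyx => ?_⟩
        have : y ∈ (wedge a b s t S).erase x :=
          Finset.mem_erase.2 ⟨fun h => by rw [h] at hyx; exact lt_irrefl _ hyx, hy⟩
        simp [he] at this
      · obtain ⟨z, hz, hzm⟩ := Finset.exists_max_image _ a he
        obtain ⟨hzx, hz⟩ := Finset.mem_erase.1 hz
        refine ⟨a z, lt_of_le_of_ne (hxm z hz) fun h => hzx (ha ?_ ?_ h), fun y hy hyx =>
          hzm y (Finset.mem_erase.2 ⟨fun h => by rw [h] at hyx; exact lt_irrefl _ hyx, hy⟩)⟩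
        · exact (mem_wedge.1 hz).1
        · exact hxw.1
    have he : wedge a b s₀ t S = (wedge a b s t S).erase x := by
      ext y
      rw [Finset.mem_erase]
      constructor
      · intro hy
        have hyw := mem_wedge.1 hy
        refine ⟨fun h => ?_, mem_wedge.2 ⟨hyw.1, by linarith [hyw.2.1, hxw.2.1], hyw.2.2⟩⟩
        rw [h] at hyw
        linarith [hyw.2.1]
      · rintro ⟨hyx, hy⟩
        have hyw := mem_wedge.1 hy
        exact mem_wedge.2 ⟨hyw.1, hs₀' y hy (lt_of_le_of_ne (hxm y hy) fun h =>
          hyx (ha hyw.1 hxw.1 h)), hyw.2.2⟩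
    have hc : (wedge a b s₀ t S).card = n := by
      rw [he, Finset.card_erase_of_mem hx, hn]
      rfl
    obtain ⟨s', hs', h'⟩ := ih (s := s₀) (by omega) hc
    exact ⟨s', by linarith [hxw.2.1], h'⟩

/-- Coloring a finite set so that all large quadrants of finitely many compatible types see all
colors. -/
lemma exists_coloring_wedge {α : Type*} (Γ : Finset ((α → ℝ) × (α → ℝ)))
    (hΓ : ∀ p ∈ Γ, ∀ q ∈ Γ, ∀ x y z : α, p.1 x < p.1 y → p.1 y < p.1 z → p.2 z < p.2 y →
      p.2 y < p.2 x → q.1 y ≤ max (q.1 x) (q.1 z) ∧ q.2 y ≤ max (q.2 x) (q.2 z))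
    (k : ℕ) (S : Finset α) (hinj : ∀ p ∈ Γ, Set.InjOn p.1 S) :
    ∃ χ : α → ℕ, ∀ p ∈ Γ, ∀ s t, 4 * Γ.card * k ≤ (wedge p.1 p.2 s t S).card →
      ∀ i < k, ∃ x ∈ wedge p.1 p.2 s t S, χ x = i := by
  classical
  induction k generalizing S with
  | zero => exact ⟨fun _ => 0, fun p _ s t _ i hi => absurd hi (by omega)⟩
  | succ k ih =>
    rcases Γ.eq_empty_or_nonempty with rfl | hne
    · exact ⟨fun _ => 0, fun p hp => by simp at hp⟩
    have hr : 1 ≤ 4 * Γ.card * (k + 1) := by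
      have := Finset.card_pos.2 hne
      exact Nat.succ_le_of_lt (by positivity)
    choose T hTS hT1 hT2 using fun p : (α → ℝ) × (α → ℝ) =>
      exists_sparse_hitting_set S p.1 p.2 hr
    obtain ⟨χ, hχ⟩ := ih (S \ Γ.biUnion T) fun p hp => (hinj p hp).mono (by simp)
    refine ⟨fun x => if x ∈ Γ.biUnion T then k else χ x, fun p hp s t hst i hi => ?_⟩
    obtain ⟨s', hs', hc⟩ := exists_wedge_card_eq (hinj p hp) hst
    have hmono : wedge p.1 p.2 s' t S ⊆ wedge p.1 p.2 s t S := by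
      intro x hx
      rw [mem_wedge] at hx ⊢
      exact ⟨hx.1, hx.2.1.trans hs', hx.2.2⟩
    rcases (Nat.lt_succ_iff.1 hi).eq_or_lt with rfl | hi
    · obtain ⟨x, hx⟩ := hT1 p s' t hc
      obtain ⟨hxT, hx⟩ := Finset.mem_inter.1 hx
      exact ⟨x, hmono hx, if_pos (Finset.mem_biUnion.2 ⟨p, hp, hxT⟩)⟩
    · have hbox : ∀ q ∈ Γ, BoxConvex q.1 q.2 S (wedge p.1 p.2 s' t S) := by
        intro q hq x hx z hz y hy h1 h2 h3 h4
        have := hΓ q hq p hp x y z h1 h2 h3 h4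
        rw [mem_wedge] at hx hz ⊢
        exact ⟨hy, this.1.trans (max_le hx.2.1 hz.2.1), this.2.trans (max_le hx.2.2 hz.2.2)⟩
      -- Each type costs at most four points, which is exactly the drop of the threshold from `k +
      -- 1` to `k`.
      have hle : (wedge p.1 p.2 s' t S ∩ Γ.biUnion T).card ≤ Γ.card * 4 := by
        rw [Finset.inter_biUnion]
        exact Finset.card_biUnion_le_card_mul _ _ _ fun q hq => hT2 q _ hc.le (hbox q hq)
      have heq : wedge p.1 p.2 s' t (S \ Γ.biUnion T) =
          wedge p.1 p.2 s' t S \ Γ.biUnion T := by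
        ext x
        simp only [mem_wedge, Finset.mem_sdiff]
        tauto
      have hcard := Finset.card_inter_add_card_sdiff (wedge p.1 p.2 s' t S) (Γ.biUnion T)
      obtain ⟨x, hx, hxi⟩ := hχ p hp s' t (by rw [heq]; rw [hc] at hcard; linarith) i hi
      rw [heq, Finset.mem_sdiff] at hx
      exact ⟨x, hmono hx.1, by simp only [if_neg hx.2, hxi]⟩

/-! ### Quadrants given by linear functionals, and removal of ties. -/

lemma inner_plane (f x : Plane) : inner ℝ f x = f 0 * x 0 + f 1 * x 1 := by
  simp [PiLp.inner_apply, Fin.sum_univ_two, mul_comm]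

/-- On boxes in the coordinates given by `p`, the functional `f` is bounded by its values at the
upper left and lower right corners. -/
def Compatible (p : Plane × Plane) (f : Plane) : Prop :=
  p.1 = p.2 ∨ ∃ l m : ℝ, l * m ≤ 0 ∧ f = l • p.1 + m • p.2

/-- The value at `x` of the functional `f` turned by an infinitesimal amount `ε`. -/
noncomputable def tilt (ε : ℝ) (f x : Plane) : ℝ :=
  inner ℝ f x + ε * (f 0 * x 1 - f 1 * x 0)

/-- Tilting is linear in `f`, so the combination survives it. If `l ≥ 0 ≥ m`, the lower right corner
dominates; with the signs exchanged, the upper left one does. When the two coordinates coincide the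
box is empty. -/
lemma Compatible.tilt_le_max {p : Plane × Plane} {f : Plane} (h : Compatible p f) (ε : ℝ)
    {x y z : Plane} (h1 : tilt ε p.1 x < tilt ε p.1 y) (h2 : tilt ε p.1 y < tilt ε p.1 z)
    (h3 : tilt ε p.2 z < tilt ε p.2 y) (h4 : tilt ε p.2 y < tilt ε p.2 x) :
    tilt ε f y ≤ max (tilt ε f x) (tilt ε f z) := by
  rcases h with h | ⟨l, m, hlm, rfl⟩
  · rw [h] at h1
    linarith
  · have e : ∀ w, tilt ε (l • p.1 + m • p.2) w = l * tilt ε p.1 w + m * tilt ε p.2 w := by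
      intro w
      simp only [tilt, inner_plane, PiLp.add_apply, PiLp.smul_apply, smul_eq_mul]
      ring
    rw [e, e, e, le_max_iff]
    rcases mul_nonpos_iff.1 hlm with ⟨hl, hm⟩ | ⟨hl, hm⟩
    · right
      nlinarith
    · left
      nlinarith

lemma eq_zero_of_inner_of_cross {f x : Plane} (hf : f ≠ 0) (h : inner ℝ f x = 0)
    (h' : f 0 * x 1 - f 1 * x 0 = 0) : x = 0 := by
  rw [inner_plane] at h
  have hpos : 0 < f 0 ^ 2 + f 1 ^ 2 := by
    by_contra! hle
    apply hf
    ext i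
    fin_cases i
    · simp only [Fin.zero_eta, PiLp.zero_apply]
      nlinarith [sq_nonneg (f 0), sq_nonneg (f 1)]
    · simp only [Fin.mk_one, PiLp.zero_apply]
      nlinarith [sq_nonneg (f 0), sq_nonneg (f 1)]
  have e0 : (f 0 ^ 2 + f 1 ^ 2) * x 0 = 0 := by linear_combination f 0 * h - f 1 * h'
  have e1 : (f 0 ^ 2 + f 1 ^ 2) * x 1 = 0 := by linear_combination f 1 * h + f 0 * h'
  ext i
  fin_cases i
  · exact (mul_eq_zero.1 e0).resolve_left hpos.ne'
  · exact (mul_eq_zero.1 e1).resolve_left hpos.ne'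

/-- A suitable tilt makes finitely many functionals injective on a finite set, without reversing
any strict inequality between their values. -/
lemma exists_tilt (F S : Finset Plane) (hF : ∀ f ∈ F, f ≠ 0) :
    ∃ ε : ℝ, ∀ f ∈ F, Set.InjOn (tilt ε f) S ∧
      ∀ x ∈ S, ∀ y ∈ S, inner ℝ f x < inner ℝ f y → tilt ε f x < tilt ε f y := by
  have key : ∀ᶠ ε in nhdsWithin (0 : ℝ) (Set.Ioi 0), ∀ f ∈ F, ∀ x ∈ S, ∀ y ∈ S,
      (tilt ε f x = tilt ε f y → x = y) ∧
        (inner ℝ f x < inner ℝ f y → tilt ε f x < tilt ε f y) := by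
    simp only [Filter.eventually_all_finset, Filter.eventually_and]
    intro f hf x hx y hy
    have hcont : ∀ w, Continuous fun ε => tilt ε f w := by
      intro w
      unfold tilt
      fun_prop
    have h0 : ∀ w, tilt 0 f w = inner ℝ f w := by simp [tilt]
    have hlt : ∀ x y : Plane, inner ℝ f x < inner ℝ f y →
        ∀ᶠ ε in nhdsWithin (0 : ℝ) (Set.Ioi 0), tilt ε f x < tilt ε f y := by
      intro x y hxy
      refine Filter.Eventually.filter_mono nhdsWithin_le_nhds ?_
      exact ((hcont x).tendsto 0).eventually_lt ((hcont y).tendsto 0) (by rwa [h0, h0])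
    constructor
    · rcases lt_trichotomy (inner ℝ f x) (inner ℝ f y) with h | h | h
      · exact (hlt x y h).mono fun ε h e => absurd e h.ne
      · filter_upwards [self_mem_nhdsWithin] with ε hε e
        rw [← sub_eq_zero]
        refine eq_zero_of_inner_of_cross (hF f hf) (by rw [inner_sub_right, h, sub_self]) ?_
        rw [tilt, tilt, h, add_right_inj] at e
        have := mul_left_cancel₀ (ne_of_gt hε) e
        simp only [PiLp.sub_apply]
        linarith
      · exact (hlt y x h).mono fun ε h e => absurd e h.ne'
    · by_cases h : inner ℝ f x < inner ℝ f y
      · exact (hlt x y h).mono fun ε h _ => h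
      · exact Filter.Eventually.of_forall fun ε h' => absurd h' h
  obtain ⟨ε, hε⟩ := key.exists
  exact ⟨ε, fun f hf => ⟨fun x hx y hy => (hε f hf x hx y hy).1,
    fun x hx y hy => (hε f hf x hx y hy).2⟩⟩

/-- A quadrant is also a quadrant in any coordinates that respect the strict order. -/
lemma exists_wedge_eq {α : Type*} {S : Finset α} {a b a' b' : α → ℝ}
    (ha : ∀ x ∈ S, ∀ y ∈ S, a x < a y → a' x < a' y)
    (hb : ∀ x ∈ S, ∀ y ∈ S, b x < b y → b' x < b' y) {s t : ℝ}
    (hne : (wedge a b s t S).Nonempty) :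
    ∃ s' t', wedge a' b' s' t' S = wedge a b s t S := by
  obtain ⟨x, hx, hxm⟩ := Finset.exists_max_image _ a' hne
  obtain ⟨z, hz, hzm⟩ := Finset.exists_max_image _ b' hne
  refine ⟨a' x, b' z, ?_⟩
  ext y
  constructor
  · intro hy
    rw [mem_wedge] at hx hz hy ⊢
    refine ⟨hy.1, ?_, ?_⟩
    · by_contra! h
      exact absurd (ha x hx.1 y hy.1 (by linarith)) (by linarith)
    · by_contra! h
      exact absurd (hb z hz.1 y hy.1 (by linarith)) (by linarith)
  · intro hy
    exact mem_wedge.2 ⟨(mem_wedge.1 hy).1, hxm y hy, hzm y hy⟩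

/-- The functionals may have ties on `S`; a tilt depending on `S` removes them, and the original
quadrants remain quadrants in the tilted coordinates. -/
lemma exists_coloring_compatible (Γ : Finset (Plane × Plane))
    (h0 : ∀ p ∈ Γ, p.1 ≠ 0 ∧ p.2 ≠ 0)
    (hΓ : ∀ p ∈ Γ, ∀ q ∈ Γ, Compatible p q.1 ∧ Compatible p q.2) (k : ℕ) (S : Finset Plane) :
    ∃ χ : Plane → ℕ, ∀ p ∈ Γ, ∀ s t,
      4 * Γ.card * k ≤ (wedge (inner ℝ p.1) (inner ℝ p.2) s t S).card →
        ∀ i < k, ∃ x ∈ wedge (inner ℝ p.1) (inner ℝ p.2) s t S, χ x = i := by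
  classical
  obtain ⟨ε, hε⟩ := exists_tilt (Γ.image Prod.fst ∪ Γ.image Prod.snd) S (by
    intro f hf
    rcases Finset.mem_union.1 hf with hf | hf
    · obtain ⟨p, hp, rfl⟩ := Finset.mem_image.1 hf
      exact (h0 p hp).1
    · obtain ⟨p, hp, rfl⟩ := Finset.mem_image.1 hf
      exact (h0 p hp).2)
  have hε1 := fun p (hp : p ∈ Γ) =>
    hε p.1 (Finset.mem_union_left _ (Finset.mem_image_of_mem _ hp))
  have hε2 := fun p (hp : p ∈ Γ) =>
    hε p.2 (Finset.mem_union_right _ (Finset.mem_image_of_mem _ hp))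
  obtain ⟨χ, hχ⟩ := exists_coloring_wedge (Γ.image fun p => (tilt ε p.1, tilt ε p.2)) (by
    intro p hp q hq x y z h1 h2 h3 h4
    obtain ⟨p, hp', rfl⟩ := Finset.mem_image.1 hp
    obtain ⟨q, hq', rfl⟩ := Finset.mem_image.1 hq
    exact ⟨(hΓ p hp' q hq').1.tilt_le_max ε h1 h2 h3 h4,
      (hΓ p hp' q hq').2.tilt_le_max ε h1 h2 h3 h4⟩) k S (by
    intro p hp
    obtain ⟨p, hp', rfl⟩ := Finset.mem_image.1 hp
    exact (hε1 p hp').1)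
  refine ⟨χ, fun p hp s t hst i hi => ?_⟩
  have hne : (wedge (inner ℝ p.1) (inner ℝ p.2) s t S).Nonempty := by
    rw [← Finset.card_pos]
    refine lt_of_lt_of_le ?_ hst
    have := Finset.card_pos.2 ⟨p, hp⟩
    have : 0 < k := by omega
    positivity
  obtain ⟨s', t', he⟩ := exists_wedge_eq (hε1 p hp).2 (hε2 p hp).2 hne
  have := hχ _ (Finset.mem_image_of_mem _ hp) s' t' (by
    rw [he]
    refine le_trans ?_ hst
    gcongr
    exact Finset.card_image_le) i hi
  rwa [he] at this

/-! ### The polar polygon and the local shape of `Q`. -/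

/-- The (one-sided) polar of a set in the plane. -/
def planePolar (Q : Set Plane) : Set Plane := {g | ∀ x ∈ Q, inner ℝ g x ≤ 1}

lemma mem_planePolar_convexHull {V : Set Plane} {g : Plane} :
    g ∈ planePolar (convexHull ℝ V) ↔ ∀ v ∈ V, inner ℝ g v ≤ 1 := by
  refine ⟨fun h v hv => h v (subset_convexHull ℝ V hv), fun h x hx => ?_⟩
  have hconv : Convex ℝ {x : Plane | inner ℝ g x ≤ 1} :=
    convex_halfSpace_le (innerSL ℝ g).toLinearMap.isLinear 1
  exact convexHull_min h hconv hx

lemma convex_planePolar (Q : Set Plane) : Convex ℝ (planePolar Q) := by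
  intro g hg h hh l m hl hm hlm x hx
  rw [inner_add_left, real_inner_smul_left, real_inner_smul_left]
  nlinarith [hg x hx, hh x hx]

lemma zero_mem_planePolar (Q : Set Plane) : 0 ∈ planePolar Q := by
  intro x _
  simp

lemma isCompact_planePolar {Q : Set Plane} (h0 : (0 : Plane) ∈ interior Q) :
    IsCompact (planePolar Q) := by
  refine Metric.isCompact_of_isClosed_isBounded ?_ ?_
  · have : planePolar Q = ⋂ x ∈ Q, {g : Plane | inner ℝ g x ≤ 1} := by
      ext g
      simp [planePolar]
    rw [this]
    exact isClosed_biInter fun x _ => isClosed_le (by fun_prop) continuous_const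
  · obtain ⟨ρ, hρ, hball⟩ := Metric.mem_nhds_iff.1 (mem_interior_iff_mem_nhds.1 h0)
    refine (Metric.isBounded_closedBall (x := (0 : Plane)) (r := 2 / ρ)).subset fun g hg => ?_
    rw [mem_closedBall_zero_iff]
    rcases eq_or_ne g 0 with rfl | hg0
    · simp only [norm_zero]
      positivity
    have hn : 0 < ‖g‖ := norm_pos_iff.2 hg0
    have := hg ((ρ / 2 / ‖g‖) • g) (hball (by
      rw [mem_ball_zero_iff, norm_smul, Real.norm_of_nonneg (by positivity),
        div_mul_cancel₀ _ hn.ne']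
      linarith))
    rw [real_inner_smul_right, real_inner_self_eq_norm_sq] at this
    rw [le_div_iff₀ hρ]
    have e : ρ / 2 / ‖g‖ * ‖g‖ ^ 2 = ρ / 2 * ‖g‖ := by
      field_simp
    linarith

/-- An extreme point is determined by its set of active vertices: if `g` and `h` share it, a short
move from `g` along `±(h - g)` stays in the polar, so `g = h`. -/
lemma finite_extremePoints_planePolar {V : Set Plane} (hV : V.Finite) :
    ((planePolar (convexHull ℝ V)).extremePoints ℝ).Finite := by
  refine Set.Finite.of_finite_image (f := fun g => {v ∈ V | inner ℝ g v = 1})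
    (hV.finite_subsets.subset ?_) ?_
  · rintro _ ⟨g, -, rfl⟩ v hv
    exact hv.1
  · intro g hg h hh hgh
    have hact : ∀ v ∈ V, inner ℝ g v = 1 → inner ℝ h v = 1 := by
      intro v hv e
      have : v ∈ {v ∈ V | inner ℝ g v = 1} := ⟨hv, e⟩
      rw [show {v ∈ V | inner ℝ g v = 1} = {v ∈ V | inner ℝ h v = 1} from hgh] at this
      exact this.2
    have hgP := mem_planePolar_convexHull.1 hg.1
    have key : ∀ᶠ ε in nhdsWithin (0 : ℝ) (Set.Ioi 0), ∀ v ∈ V,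
        inner ℝ (g + ε • (h - g)) v ≤ 1 ∧ inner ℝ (g - ε • (h - g)) v ≤ 1 := by
      rw [Filter.eventually_all_finite hV]
      intro v hv
      rcases (hgP v hv).eq_or_lt with e | e
      · have e' := hact v hv e
        refine Filter.Eventually.of_forall fun ε => ?_
        simp [inner_add_left, inner_sub_left, real_inner_smul_left, e, e']
      · refine Filter.Eventually.filter_mono nhdsWithin_le_nhds (Filter.Eventually.and ?_ ?_)
        · have hc : Continuous fun ε : ℝ => inner ℝ (g + ε • (h - g)) v := by fun_prop
          exact ((hc.tendsto 0).eventually_lt_const (by simpa using e)).mono fun _ => le_of_lt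
        · have hc : Continuous fun ε : ℝ => inner ℝ (g - ε • (h - g)) v := by fun_prop
          exact ((hc.tendsto 0).eventually_lt_const (by simpa using e)).mono fun _ => le_of_lt
    obtain ⟨ε, hε, hpos⟩ := (key.and self_mem_nhdsWithin).exists
    have := hg.2 (mem_planePolar_convexHull.2 fun v hv => (hε v hv).1)
      (mem_planePolar_convexHull.2 fun v hv => (hε v hv).2)
      ⟨1 / 2, 1 / 2, by norm_num, by norm_num, by norm_num, by module⟩
    rw [add_eq_left, smul_eq_zero] at this
    exact (sub_eq_zero.1 (this.resolve_left (ne_of_gt hpos))).symm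

/-- A closed convex set with the origin in its interior is cut out by the extreme points of its
polar, if these are finitely many. -/
lemma mem_iff_forall_extremePoints_planePolar {Q : Set Plane} (hc : Convex ℝ Q)
    (hcl : IsClosed Q) (h0 : (0 : Plane) ∈ interior Q)
    (hfin : ((planePolar Q).extremePoints ℝ).Finite) {x : Plane} :
    x ∈ Q ↔ ∀ f ∈ (planePolar Q).extremePoints ℝ, inner ℝ f x ≤ 1 := by
  refine ⟨fun hx f hf => hf.1 x hx, fun h => ?_⟩
  -- By Krein–Milman the bounds pass from the extreme points to the whole polar; a functional
  -- separating `x` from `Q`, normalized to be at most `1` on `Q`, then gives a contradiction.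
  have hall : ∀ g ∈ planePolar Q, inner ℝ g x ≤ 1 := by
    rw [← closure_convexHull_extremePoints (isCompact_planePolar h0) (convex_planePolar Q),
      (hfin.isClosed_convexHull ℝ).closure_eq]
    intro g hg
    rw [real_inner_comm]
    refine mem_planePolar_convexHull.2 (fun f hf => ?_) g hg
    rw [real_inner_comm]
    exact h f hf
  by_contra hx
  obtain ⟨φ, u, hu, hux⟩ := geometric_hahn_banach_closed_point hc hcl hx
  have hu0 : 0 < u := by simpa using hu 0 (interior_subset h0)
  set g := (InnerProductSpace.toDual ℝ Plane).symm φ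
  have hg : ∀ y, inner ℝ g y = φ y := fun y => InnerProductSpace.toDual_symm_apply
  have := hall (u⁻¹ • g) (fun y hy => by
    rw [real_inner_smul_left, hg, inv_mul_le_iff₀ hu0, mul_one]
    exact (hu y hy).le)
  rw [real_inner_smul_left, hg, inv_mul_le_iff₀ hu0, mul_one] at this
  linarith

lemma neg_mem_extremePoints_planePolar {Q : Set Plane} (hs : ∀ x ∈ Q, -x ∈ Q) {f : Plane}
    (hf : f ∈ (planePolar Q).extremePoints ℝ) : -f ∈ (planePolar Q).extremePoints ℝ := by
  have hneg : ∀ g ∈ planePolar Q, -g ∈ planePolar Q := by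
    intro g hg x hx
    rw [inner_neg_left, ← inner_neg_right]
    exact hg _ (hs x hx)
  refine ⟨hneg f hf.1, fun x hx y hy hxy => ?_⟩
  obtain ⟨l, m, hl, hm, hlm, he⟩ := hxy
  have := hf.2 (hneg x hx) (hneg y hy) ⟨l, m, hl, hm, hlm, by
    rw [smul_neg, smul_neg, ← neg_add, he, neg_neg]⟩
  rw [← this, neg_neg]

/-- Distinct points on a line missing the origin are linearly independent; the coefficients come
from Cramer's rule. -/
lemma exists_combination_of_inner_eq_one {a b z : Plane} (hab : a ≠ b) (ha : inner ℝ a z = 1)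
    (hb : inner ℝ b z = 1) (f : Plane) : ∃ l m : ℝ, f = l • a + m • b := by
  rw [inner_plane] at ha hb
  have hdet : a 0 * b 1 - a 1 * b 0 ≠ 0 := by
    intro h
    apply hab
    ext i
    fin_cases i
    · simp only [Fin.zero_eta]
      linear_combination (-(a 0)) * hb + b 0 * ha + z 1 * h
    · simp only [Fin.mk_one]
      linear_combination (-(a 1)) * hb + b 1 * ha - z 0 * h
  refine ⟨(f 0 * b 1 - f 1 * b 0) / (a 0 * b 1 - a 1 * b 0),
    (a 0 * f 1 - a 1 * f 0) / (a 0 * b 1 - a 1 * b 0), ?_⟩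
  ext i
  fin_cases i
  · simp only [Fin.zero_eta, PiLp.add_apply, PiLp.smul_apply, smul_eq_mul]
    rw [div_mul_eq_mul_div, div_mul_eq_mul_div, ← add_div, eq_div_iff hdet]
    ring
  · simp only [Fin.mk_one, PiLp.add_apply, PiLp.smul_apply, smul_eq_mul]
    rw [div_mul_eq_mul_div, div_mul_eq_mul_div, ← add_div, eq_div_iff hdet]
    ring

/-- No extreme point of `P` is a positive combination of two other points of `P` on a common
supporting line. -/
lemma not_pos_combination_of_mem_extremePoints {P : Set Plane} (hP : Convex ℝ P)
    (h0 : (0 : Plane) ∈ P) {a b f z : Plane} (hab : a ≠ b) (ha : a ∈ P) (hb : b ∈ P)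
    (haz : inner ℝ a z = 1) (hbz : inner ℝ b z = 1) (hf : f ∈ P.extremePoints ℝ)
    (hfz : inner ℝ f z ≤ 1) {l m : ℝ} (hl : 0 < l) (hm : 0 < m) (he : f = l • a + m • b) :
    False := by
  have hz : inner ℝ f z = l + m := by
    rw [he, inner_add_left, real_inner_smul_left, real_inner_smul_left, haz, hbz]
    ring
  have hl1 : 0 < 1 - l := by linarith
  -- As `l + m ≤ 1`, this is `b` shrunk towards `0`. It exhibits `f` as a proper convex combination
  -- with `a`, so extremality forces `a = f`.
  have hw : (m / (1 - l)) • b ∈ P := by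
    have h1 : m / (1 - l) ≤ 1 := by
      rw [div_le_one hl1]
      linarith
    have := hP hb h0 (a := m / (1 - l)) (b := 1 - m / (1 - l)) (by positivity) (by linarith)
      (by ring)
    simpa using this
  have hfa : a = f := hf.2 ha hw ⟨l, 1 - l, hl, hl1, by ring, by
    rw [smul_smul, mul_div_cancel₀ _ hl1.ne', he]⟩
  rw [← hfa, haz] at hz
  have hml : m = 1 - l := by linarith
  rw [← hfa, hml] at he
  have h2 : (1 - l) • (a - b) = 0 := by
    rw [smul_sub, sub_eq_zero, sub_smul, one_smul, sub_eq_iff_eq_add]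
    rw [add_comm]
    exact he
  rcases smul_eq_zero.1 h2 with h2 | h2
  · linarith
  · exact hab (sub_eq_zero.1 h2)

/-- For `m < 0`, solving for `a` places it in the open segment from `f` to `b`. -/
lemma eq_of_mem_extremePoints_of_affine {P : Set Plane} {a b f : Plane}
    (ha : a ∈ P.extremePoints ℝ) (hb : b ∈ P) (hf : f ∈ P) {l m : ℝ} (hlm : l + m = 1)
    (hm : m ≤ 0) (he : f = l • a + m • b) : f = a := by
  rcases hm.eq_or_lt with rfl | hm
  · simp only [add_zero] at hlm
    simp [he, hlm]
  · have hl : 0 < l := by linarith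
    refine ha.2 hf hb ⟨1 / l, -m / l, by positivity, div_pos (by linarith) hl, ?_, ?_⟩
    · field_simp
      linarith
    · rw [he, smul_add, smul_smul, smul_smul, add_assoc, ← add_smul, one_div_mul_cancel hl.ne',
        one_smul]
      have : 1 / l * m + -m / l = 0 := by ring
      rw [this, zero_smul, add_zero]

/-- Around each of its points, a centrally symmetric polygon is a quadrant, and there are only
finitely many mutually compatible types of these. -/
lemma exists_local_wedges {V : Set Plane} (hV : V.Finite)
    (h0 : (0 : Plane) ∈ interior (convexHull ℝ V)) (hs : ∀ x ∈ convexHull ℝ V, -x ∈ convexHull ℝ V) :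
    ∃ Γ : Finset (Plane × Plane), (∀ p ∈ Γ, p.1 ≠ 0 ∧ p.2 ≠ 0) ∧
      (∀ p ∈ Γ, ∀ q ∈ Γ, Compatible p q.1 ∧ Compatible p q.2) ∧
      ∀ z ∈ convexHull ℝ V, ∃ p ∈ Γ, ∃ U : Set Plane, IsOpen U ∧ z ∈ U ∧
        ∀ x ∈ U, x ∈ convexHull ℝ V ↔ inner ℝ p.1 x ≤ 1 ∧ inner ℝ p.2 x ≤ 1 := by
  classical
  set Q := convexHull ℝ V with hQ
  set P := planePolar Q
  have hfin := finite_extremePoints_planePolar hV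
  -- The zero functional imposes no constraint, and tilting requires nonzero ones.
  set F : Finset Plane := hfin.toFinset.erase 0 with hF
  have hmem : ∀ f, f ∈ F ↔ f ≠ 0 ∧ f ∈ P.extremePoints ℝ := by
    intro f
    simp [hF, P, hQ]
  have hQF : ∀ x, x ∈ Q ↔ ∀ f ∈ F, inner ℝ f x ≤ 1 := by
    intro x
    rw [mem_iff_forall_extremePoints_planePolar (convex_convexHull ℝ V) (hV.isClosed_convexHull ℝ) h0
      hfin]
    refine ⟨fun h f hf => h f ((hmem f).1 hf).2, fun h f hf => ?_⟩
    rcases eq_or_ne f 0 with rfl | hf0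
    · simp
    · exact h f ((hmem f).2 ⟨hf0, hf⟩)
  have hFne : F.Nonempty := by
    by_contra hne
    rw [Finset.not_nonempty_iff_eq_empty] at hne
    have huniv : Q = Set.univ := by
      ext x
      simp [hQF x, hne]
    exact noncompact_univ Plane (huniv ▸ hV.isCompact_convexHull ℝ)
  have hFneg : ∀ f ∈ F, -f ∈ F := by
    intro f hf
    rw [hmem] at hf ⊢
    exact ⟨neg_ne_zero.2 hf.1, neg_mem_extremePoints_planePolar hs hf.2⟩
  refine ⟨(F ×ˢ F).filter fun p => ∀ f ∈ F, Compatible p f, ?_, ?_, ?_⟩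
  · intro p hp
    obtain ⟨hp, -⟩ := Finset.mem_filter.1 hp
    obtain ⟨h1, h2⟩ := Finset.mem_product.1 hp
    exact ⟨((hmem _).1 h1).1, ((hmem _).1 h2).1⟩
  · intro p hp q hq
    obtain ⟨-, hp⟩ := Finset.mem_filter.1 hp
    obtain ⟨hq, -⟩ := Finset.mem_filter.1 hq
    obtain ⟨h1, h2⟩ := Finset.mem_product.1 hq
    exact ⟨hp _ h1, hp _ h2⟩
  · intro z hz
    rw [hQF] at hz
    -- Constraints other than `a` and `b` are strict at `z`, hence hold on a neighborhood.
    suffices h : ∃ a ∈ F, ∃ b ∈ F, (∀ f ∈ F, Compatible (a, b) f) ∧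
        ∀ f ∈ F, inner ℝ f z = 1 → f = a ∨ f = b by
      obtain ⟨a, ha, b, hb, hcomp, hact⟩ := h
      refine ⟨(a, b), Finset.mem_filter.2 ⟨Finset.mk_mem_product ha hb, hcomp⟩,
        ⋂ f ∈ F.filter (fun f => f ≠ a ∧ f ≠ b), {x | inner ℝ f x < 1}, ?_, ?_, ?_⟩
      · exact isOpen_biInter_finset fun f _ => isOpen_lt (by fun_prop) continuous_const
      · simp only [Set.mem_iInter]
        intro f hf
        obtain ⟨hf, hfa, hfb⟩ := Finset.mem_filter.1 hf
        refine lt_of_le_of_ne (hz f hf) fun h => ?_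
        rcases hact f hf h with h | h
        · exact hfa h
        · exact hfb h
      · intro x hx
        simp only [Set.mem_iInter] at hx
        rw [hQF]
        refine ⟨fun h => ⟨h a ha, h b hb⟩, fun h f hf => ?_⟩
        by_cases hfa : f = a
        · rw [hfa]
          exact h.1
        by_cases hfb : f = b
        · rw [hfb]
          exact h.2
        · exact (hx f (Finset.mem_filter.2 ⟨hf, hfa, hfb⟩)).le
    by_cases hex : ∃ a ∈ F, ∃ b ∈ F, a ≠ b ∧ inner ℝ a z = 1 ∧ inner ℝ b z = 1
    · obtain ⟨a, ha, b, hb, hab, haz, hbz⟩ := hex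
      have ha' := ((hmem a).1 ha).2
      have hb' := ((hmem b).1 hb).2
      have hsign : ∀ f ∈ F, ∀ l m : ℝ, f = l • a + m • b → l * m ≤ 0 := by
        intro f hf l m he
        by_contra! hlm
        rcases mul_pos_iff.1 hlm with ⟨hl, hm⟩ | ⟨hl, hm⟩
        · exact not_pos_combination_of_mem_extremePoints (convex_planePolar Q)
            (zero_mem_planePolar Q) hab ha'.1 hb'.1 haz hbz ((hmem f).1 hf).2 (hz f hf) hl hm he
        -- Here central symmetry is used: both coefficients are negative, so the positive case
        -- applies to `-f`.
        · refine not_pos_combination_of_mem_extremePoints (convex_planePolar Q)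
            (zero_mem_planePolar Q) hab ha'.1 hb'.1 haz hbz ((hmem _).1 (hFneg f hf)).2
            (hz _ (hFneg f hf)) (l := -l) (m := -m) (by linarith) (by linarith) ?_
          rw [he]
          module
      refine ⟨a, ha, b, hb, fun f hf => ?_, fun f hf hfz => ?_⟩
      · obtain ⟨l, m, he⟩ := exists_combination_of_inner_eq_one hab haz hbz f
        exact Or.inr ⟨l, m, hsign f hf l m he, he⟩
      · obtain ⟨l, m, he⟩ := exists_combination_of_inner_eq_one hab haz hbz f
        have hlm : l + m = 1 := by
          rw [he, inner_add_left, real_inner_smul_left, real_inner_smul_left, haz, hbz] at hfz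
          linarith
        have hf' := ((hmem f).1 hf).2.1
        rcases mul_nonpos_iff.1 (hsign f hf l m he) with ⟨-, hm⟩ | ⟨hl, -⟩
        · exact Or.inl (eq_of_mem_extremePoints_of_affine ha' hb'.1 hf' hlm hm he)
        · exact Or.inr (eq_of_mem_extremePoints_of_affine hb' ha'.1 hf' (l := m) (m := l)
            (by linarith) hl (by rw [he, add_comm]))
    -- At most one constraint is active; the type degenerates to a half-plane, with both coordinates
    -- equal.
    · push Not at hex
      by_cases hone : ∃ a ∈ F, inner ℝ a z = 1
      · obtain ⟨a, ha, haz⟩ := hone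
        refine ⟨a, ha, a, ha, fun f _ => Or.inl rfl, fun f hf hfz => Or.inl ?_⟩
        by_contra hne
        exact hex f hf a ha hne hfz haz
      · push Not at hone
        obtain ⟨a, ha⟩ := hFne
        exact ⟨a, ha, a, ha, fun f _ => Or.inl rfl, fun f hf hfz => absurd hfz (hone f hf)⟩

/-! ### The grid, and the passage from cells to the plane. -/

/-- The index of the square of side `η` containing `x`. -/
noncomputable def gridCell (η : ℝ) (x : Plane) : ℤ × ℤ := (⌊x 0 / η⌋, ⌊x 1 / η⌋)

lemma dist_lt_of_gridCell_eq {η : ℝ} (hη : 0 < η) {x y : Plane}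
    (h : gridCell η x = gridCell η y) : dist x y < 2 * η := by
  have hi : ∀ s t : ℝ, ⌊s / η⌋ = ⌊t / η⌋ → |s - t| < η := by
    intro s t h
    have := Int.abs_sub_lt_one_of_floor_eq_floor h
    rwa [← sub_div, abs_div, abs_of_pos hη, div_lt_one hη] at this
  have h0 := hi _ _ (Prod.ext_iff.1 h).1
  have h1 := hi _ _ (Prod.ext_iff.1 h).2
  rw [EuclideanSpace.dist_eq, Fin.sum_univ_two, Real.sqrt_lt' (by linarith), Real.dist_eq,
    Real.dist_eq]
  nlinarith [abs_nonneg (x 0 - y 0), abs_nonneg (x 1 - y 1)]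

lemma IsLocallyFinite.finite_inter_gridCell {S : Set Plane} (hS : IsLocallyFinite S) {η : ℝ}
    (hη : 0 < η) (c : ℤ × ℤ) : (S ∩ {x | gridCell η x = c}).Finite := by
  rcases (S ∩ {x | gridCell η x = c}).eq_empty_or_nonempty with h | ⟨y, -, hy⟩
  · rw [h]
    exact Set.finite_empty
  · refine (hS _ (isCompact_closedBall y (2 * η))).subset ?_
    rintro x ⟨hxS, hx⟩
    exact ⟨hxS, (dist_lt_of_gridCell_eq hη
      ((show gridCell η x = c from hx).trans (show gridCell η y = c from hy).symm)).le⟩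

/-- The number of grid cells needed to cover a disk depends only on the radius. -/
lemma exists_card_gridCell_le {η : ℝ} (hη : 0 < η) (R : ℝ) :
    ∃ M : ℕ, ∀ v : Plane, ∃ I : Finset (ℤ × ℤ), I.card ≤ M ∧
      ∀ x, dist x v ≤ R → gridCell η x ∈ I := by
  refine ⟨(⌊2 * R / η⌋ + 2).toNat * (⌊2 * R / η⌋ + 2).toNat, fun v =>
    ⟨Finset.Icc ⌊(v 0 - R) / η⌋ ⌊(v 0 + R) / η⌋ ×ˢ Finset.Icc ⌊(v 1 - R) / η⌋ ⌊(v 1 + R) / η⌋,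
      ?_, ?_⟩⟩
  · have hc : ∀ w : ℝ, (Finset.Icc ⌊(w - R) / η⌋ ⌊(w + R) / η⌋).card ≤
        (⌊2 * R / η⌋ + 2).toNat := by
      intro w
      rw [Int.card_Icc]
      refine Int.toNat_le_toNat ?_
      have h1 := Int.le_floor_add_floor ((w - R) / η) (2 * R / η)
      rw [← add_div, show w - R + 2 * R = w + R by ring] at h1
      omega
    rw [Finset.card_product]
    exact Nat.mul_le_mul (hc _) (hc _)
  · intro x hx
    have hi : ∀ i, |x i - v i| ≤ R := by
      intro i
      refine le_trans ?_ hx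
      have := PiLp.norm_apply_le (x - v) i
      rwa [PiLp.sub_apply, Real.norm_eq_abs, ← dist_eq_norm] at this
    have hj : ∀ i, ⌊x i / η⌋ ∈ Finset.Icc ⌊(v i - R) / η⌋ ⌊(v i + R) / η⌋ := by
      intro i
      have := abs_le.1 (hi i)
      rw [Finset.mem_Icc]
      constructor <;> refine Int.floor_le_floor (div_le_div_of_nonneg_right ?_ hη.le) <;> linarith
    exact Finset.mem_product.2 ⟨hj 0, hj 1⟩

lemma exists_coloring_of_neg_mem {V : Set Plane} (hV : V.Finite)
    (h0 : (0 : Plane) ∈ interior (convexHull ℝ V))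
    (hs : ∀ x ∈ convexHull ℝ V, -x ∈ convexHull ℝ V) :
    ∃ α : ℝ, 0 < α ∧
      ∀ S : Set Plane, IsLocallyFinite S → ∀ k : ℕ, 1 ≤ k →
        ∃ χ : S → Fin k, ∀ v : Plane,
          α * (k : ℝ) ≤ ((S ∩ (v +ᵥ convexHull ℝ V)).ncard : ℝ) →
            ∀ i : Fin k, ∃ p : S, (p : Plane) ∈ v +ᵥ convexHull ℝ V ∧ χ p = i := by
  classical
  obtain ⟨Γ, hΓ0, hΓ, hloc⟩ := exists_local_wedges hV h0 hs
  have hcomp := hV.isCompact_convexHull ℝ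
  set Q := convexHull ℝ V
  choose! p hp U hUo hzU hU using hloc
  obtain ⟨δ, hδ, hleb⟩ := lebesgue_number_lemma_of_metric hcomp (c := fun z : Q => U z)
    (fun z => hUo z z.2) (fun z hz => Set.mem_iUnion.2 ⟨⟨z, hz⟩, hzU z hz⟩)
  obtain ⟨R, hR⟩ := hcomp.isBounded.subset_closedBall 0
  -- Points in a cell of side `δ / 2` are at distance less than `δ`, the Lebesgue number, so a cell
  -- meeting a translate lies in one local neighborhood.
  have hη : 0 < δ / 2 := by linarith
  obtain ⟨M, hM⟩ := exists_card_gridCell_le hη R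
  -- The summand `1` makes the pigeonhole inequality strict, as `k ≥ 1`.
  refine ⟨M * (4 * Γ.card) + 1, by positivity, fun S hS k hk => ?_⟩
  have hfin := hS.finite_inter_gridCell hη
  choose χ hχ using fun c => exists_coloring_compatible Γ hΓ0 hΓ k (hfin c).toFinset
  -- Reduction modulo `k` only affects colors outside the required range.
  refine ⟨fun x => ⟨χ (gridCell (δ / 2) x) x % k, Nat.mod_lt _ hk⟩, fun v hv i => ?_⟩
  have hmemQ : ∀ x, x ∈ v +ᵥ Q ↔ x - v ∈ Q := by
    intro x
    rw [Set.mem_vadd_set_iff_neg_vadd_mem, vadd_eq_add, neg_add_eq_sub]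
  have hSQ : (S ∩ (v +ᵥ Q)).Finite := hS _ (hcomp.vadd v)
  rw [Set.ncard_eq_toFinset_card _ hSQ] at hv
  obtain ⟨I, hIM, hI⟩ := hM v
  have hmaps : ∀ x ∈ hSQ.toFinset, gridCell (δ / 2) x ∈ I := by
    intro x hx
    rw [Set.Finite.mem_toFinset] at hx
    refine hI x ?_
    have := hR ((hmemQ x).1 hx.2)
    rwa [mem_closedBall_zero_iff, ← dist_eq_norm] at this
  have hcard : I.card * (4 * Γ.card * k) < hSQ.toFinset.card := by
    have h1 : M * (4 * Γ.card) * k + k ≤ hSQ.toFinset.card := by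
      have : ((M * (4 * Γ.card) * k + k : ℕ) : ℝ) ≤ hSQ.toFinset.card := by
        refine le_trans (le_of_eq ?_) hv
        push_cast
        ring
      exact_mod_cast this
    calc I.card * (4 * Γ.card * k) ≤ M * (4 * Γ.card * k) := Nat.mul_le_mul_right _ hIM
      _ < M * (4 * Γ.card) * k + k := by rw [← mul_assoc]; omega
      _ ≤ _ := h1
  obtain ⟨c, -, hc⟩ := Finset.exists_lt_card_fiber_of_mul_lt_card_of_maps_to hmaps hcard
  obtain ⟨y, hy⟩ := Finset.card_pos.1 (lt_of_le_of_lt (Nat.zero_le _) hc)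
  obtain ⟨hy, hyc⟩ := Finset.mem_filter.1 hy
  have hyQ := (hmemQ y).1 ((Set.Finite.mem_toFinset _).1 hy).2
  obtain ⟨⟨z, hz⟩, hball⟩ := hleb _ hyQ
  have hwedge : ∀ x, gridCell (δ / 2) x = c →
      (x ∈ v +ᵥ Q ↔ inner ℝ (p z).1 x ≤ 1 + inner ℝ (p z).1 v ∧
        inner ℝ (p z).2 x ≤ 1 + inner ℝ (p z).2 v) := by
    intro x hx
    have hxU : x - v ∈ U z := hball (by
      rw [Metric.mem_ball, dist_sub_right]
      have := dist_lt_of_gridCell_eq hη (hx.trans hyc.symm)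
      linarith)
    rw [hmemQ, hU z hz _ hxU, inner_sub_right, inner_sub_right, sub_le_iff_le_add,
      sub_le_iff_le_add]
  have heq : hSQ.toFinset.filter (fun x => gridCell (δ / 2) x = c) =
      wedge (inner ℝ (p z).1) (inner ℝ (p z).2) (1 + inner ℝ (p z).1 v) (1 + inner ℝ (p z).2 v)
        (hfin c).toFinset := by
    ext x
    rw [Finset.mem_filter, mem_wedge, Set.Finite.mem_toFinset, Set.Finite.mem_toFinset]
    constructor
    · rintro ⟨⟨hxS, hx⟩, hxc⟩
      exact ⟨⟨hxS, hxc⟩, (hwedge x hxc).1 hx⟩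
    · rintro ⟨⟨hxS, hxc⟩, hx⟩
      exact ⟨⟨hxS, (hwedge x hxc).2 hx⟩, hxc⟩
  rw [heq] at hc
  obtain ⟨x, hx, hxi⟩ := hχ c (p z) (hp z hz) _ _ hc.le i i.2
  rw [← heq, Finset.mem_filter, Set.Finite.mem_toFinset] at hx
  refine ⟨⟨x, hx.1.1⟩, hx.1.2, Fin.ext ?_⟩
  simp only [hx.2, hxi]
  exact Nat.mod_eq_of_lt i.2

theorem theorem2 (Q : Set Plane) (hQ : IsConvexPolygon Q) (hsymm : IsCentrallySymmetric Q) :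
    ∃ α : ℝ, 0 < α ∧
      ∀ S : Set Plane, IsLocallyFinite S → ∀ k : ℕ, 1 ≤ k →
        ∃ χ : S → Fin k, ∀ v : Plane,
          α * (k : ℝ) ≤ ((S ∩ (v +ᵥ Q)).ncard : ℝ) →
            ∀ i : Fin k, ∃ p : S, (p : Plane) ∈ v +ᵥ Q ∧ χ p = i := by
  obtain ⟨⟨V, hV, rfl⟩, hint⟩ := hQ
  obtain ⟨c, hc⟩ := hsymm
  have hhull : convexHull ℝ (-c +ᵥ V) = -c +ᵥ convexHull ℝ V := convexHull_vadd (-c) V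
  have hmem : ∀ x, x ∈ convexHull ℝ (-c +ᵥ V) ↔ c + x ∈ convexHull ℝ V := by
    intro x
    rw [hhull, Set.mem_vadd_set_iff_neg_vadd_mem, neg_neg, vadd_eq_add]
  have hs : ∀ x ∈ convexHull ℝ (-c +ᵥ V), -x ∈ convexHull ℝ (-c +ᵥ V) := by
    intro x hx
    rw [hmem] at hx ⊢
    rw [← hc]
    refine ⟨c + x, hx, ?_⟩
    rw [Equiv.pointReflection_apply]
    simp only [vsub_eq_sub, vadd_eq_add]
    abel
  -- The origin is the midpoint of an interior point and its mirror image.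
  have h0 : (0 : Plane) ∈ interior (convexHull ℝ (-c +ᵥ V)) := by
    obtain ⟨y, hy⟩ := hint
    have hy' : y - c ∈ interior (convexHull ℝ (-c +ᵥ V)) := by
      rw [hhull, interior_vadd, Set.mem_vadd_set_iff_neg_vadd_mem, neg_neg, vadd_eq_add]
      simpa using hy
    have hneg : -(y - c) ∈ interior (convexHull ℝ (-c +ᵥ V)) := by
      have hset : -convexHull ℝ (-c +ᵥ V) = convexHull ℝ (-c +ᵥ V) := by
        ext x
        rw [Set.mem_neg]
        exact ⟨fun h => by simpa using hs _ h, hs x⟩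
      have h := (Homeomorph.neg Plane).preimage_interior (convexHull ℝ (-c +ᵥ V))
      rw [show Homeomorph.neg Plane ⁻¹' convexHull ℝ (-c +ᵥ V) = convexHull ℝ (-c +ᵥ V) from
        hset] at h
      rw [← h] at hy'
      exact hy'
    have := (convex_convexHull ℝ (-c +ᵥ V)).interior hy' hneg (a := 1 / 2) (b := 1 / 2)
      (by norm_num) (by norm_num) (by norm_num)
    rwa [smul_neg, add_neg_cancel] at this
  obtain ⟨α, hα, h⟩ := exists_coloring_of_neg_mem hV.vadd_set h0 hs
  refine ⟨α, hα, fun S hS k hk => ?_⟩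
  obtain ⟨χ, hχ⟩ := h S hS k hk
  refine ⟨χ, fun v hv => ?_⟩
  have := hχ (v + c)
  rw [hhull, vadd_vadd, add_neg_cancel_right] at this
  exact this hv
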